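/- Let $(X_a)_{a\in T}$ be a family of jointly Normally distributed real random variables with mean zero (an arbitrary, possibly degenerate, covariance matrix is allowed). A \emph{singlet} is one of the variables $X_a$, and a \emph{doublet} is a product $X_aX_b$ of two of them (possibly $a=b$); indices may be repeated. For random variables $Y_1,\dots,Y_\ell$ the joint cumulant is $$\kappa(Y_1,\dots,Y_\ell)=\left.\frac{\partial^\ell}{\partial t_1\cdots\partial t_\ell}\ln \mathbb{E}\left[e^{t_1Y_1+\cdots+t_\ell Y_\ell}\right]\right|_{t_1=\cdots=t_\ell=0}.$$ In the subscript of $\kappa$, a simple index $a$ denotes the singlet $X_a$, and a pair $(a,b)$ denotes the doublet $X_aX_b$. If each $Y_i$ is a singlet or a doublet, then the expectation is finite for all $t$ in a neighbourhood of $0$, its logarithm is $\ell$ times continuously differentiable near $0$, so that the cumulant is well defined, and the following hold. 1. A joint cumulant with exactly one singlet and any number (possibly zero) of doublets is zero. 2. A joint cumulant with more than two singlets and any number (possibly zero) of doublets is zero. 3. A joint cumulant with exactly two singlets equals the cumulant in which these two singlets are replaced by the single doublet that is their product, whatever the order of the entries: for all $k\ge 1$ and all indices $a_1,\dots,a_{2k}\in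 T$, $$\kappa_{a_1,a_2,(a_3,a_4),\dots,(a_{2k-1},a_{2k})}=\kappa_{(a_1,a_2),(a_3,a_4),\dots,(a_{2k-1},a_{2k})},$$ and the same holds if the entries on either side are permuted. -/

import Mathlib

open MeasureTheory ProbabilityTheory

/-- The joint moment-generating function `M(t₁, …, t_ℓ) = 𝔼[exp (t₁ Y₁ + ⋯ + t_ℓ Y_ℓ)]` of a
finite family of real random variables. -/
noncomputable def jointMGF {Ω : Type*} {mΩ : MeasurableSpace Ω} (P : Measure Ω) {l : ℕ}
    (Y : Fin l → Ω → ℝ) (t : Fin l → ℝ) : ℝ :=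
  ∫ ω, Real.exp (∑ i, t i * Y i ω) ∂P

/-- The logarithm of the joint moment-generating function. -/
noncomputable def jointCGF {Ω : Type*} {mΩ : MeasurableSpace Ω} (P : Measure Ω) {l : ℕ}
    (Y : Fin l → Ω → ℝ) (t : Fin l → ℝ) : ℝ :=
  Real.log (jointMGF P Y t)

/-- The joint cumulant `κ_{1,…,ℓ}` of `Y₁, …, Y_ℓ`: the mixed partial derivative
`∂^ℓ / ∂t₁ ⋯ ∂t_ℓ` of `log M` at `t = 0`, written as the `ℓ`-th derivative of `log M` at `0`
applied to the standard basis vectors `e₁, …, e_ℓ`. -/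
noncomputable def jointCumulant {Ω : Type*} {mΩ : MeasurableSpace Ω} (P : Measure Ω) {l : ℕ}
    (Y : Fin l → Ω → ℝ) : ℝ :=
  iteratedFDeriv ℝ l (jointCGF P Y) 0 (fun i => Pi.single i 1)

/-- The joint cumulant of `Y₁, …, Y_ℓ` is well defined: the expectation in `M(t)` converges for
all `t` in a neighbourhood of `0`, and `log M` is `ℓ` times continuously differentiable there, so
that no junk value enters `jointCumulant`. -/
def JointCumulantExists {Ω : Type*} {mΩ : MeasurableSpace Ω} (P : Measure Ω) {l : ℕ}
    (Y : Fin l → Ω → ℝ) : Prop :=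
  (∀ᶠ t in nhds (0 : Fin l → ℝ), Integrable (fun ω => Real.exp (∑ i, t i * Y i ω)) P) ∧
    ContDiffAt ℝ l (jointCGF P Y) 0

/-- An entry of a cumulant: `singlet a` stands for the variable `X_a`, and `doublet a b` for the
product `X_a X_b` (with `a = b` allowed). -/
inductive CumulantEntry (T : Type*) where
  | singlet (a : T) : CumulantEntry T
  | doublet (a b : T) : CumulantEntry T

namespace CumulantEntry

/-- The random variable denoted by an entry. -/
def toRV {T Ω : Type*} (X : T → Ω → ℝ) : CumulantEntry T → Ω → ℝ
  | singlet a => fun ω => X a ω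
  | doublet a b => fun ω => X a ω * X b ω

/-- Whether an entry is a singlet. -/
def isSinglet {T : Type*} : CumulantEntry T → Bool
  | singlet _ => true
  | doublet _ _ => false

end CumulantEntry

/-- The family of random variables denoted by a list of entries; for instance
`[singlet 1, singlet 2, doublet 3 4]` denotes `X₁, X₂, X₃X₄`. -/
def entryFamily {T Ω : Type*} (X : T → Ω → ℝ) (L : List (CumulantEntry T)) :
    Fin L.length → Ω → ℝ :=
  fun i => (L.get i).toRV X

/-- The cumulant `κ_L` of a list of singlets and doublets; for instance
`κ_{1,2,(3,4)}` is `mixedCumulant P X [singlet 1, singlet 2, doublet 3 4]`. -/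
noncomputable def mixedCumulant {T Ω : Type*} {mΩ : MeasurableSpace Ω} (P : Measure Ω)
    (X : T → Ω → ℝ) (L : List (CumulantEntry T)) : ℝ :=
  jointCumulant P (entryFamily X L)

/-! Every cumulant in question is a mixed derivative at `0` of one function, F(s, q) = log E exp(∑
sᵢxᵢ + ∑ qᵢⱼxᵢxⱼ): singlets differentiate in s, doublets in q. Fernique's theorem makes F finite and
smooth near `0`. If x, y are independent copies of a centred Gaussian vector, rotating (x, y) by π/4
preserves their law. This gives F(√2 s, q) + F(0, q) = 2 F(s, q) (`linQuadMGF_sq`,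
`two_smul_linQuadCGF`). Let D be a derivative at s = 0 with p singlets. Then (√2^p + 0^p) D = 2D, so
D = 0 unless p is 0 or 2 (`dirDeriv_linQuadCGF_eq_zero`). For p = 2, let u, v be singlet directions
and w their doublet. Since ∂ᵤ∂ᵥ and ∂_w agree on the moment-generating function, ∂_w F = ∂ᵤ∂ᵥF + ∂ᵤF
∂ᵥF. By the case p = 1 the product vanishes on all of s = 0, hence so do its q-derivatives there
(`dirDeriv_linQuadCGF_append_pair`). -/

/-! ### Calculus of iterated directional derivatives -/

section DirectionalDerivatives

variable {E E' : Type*} [NormedAddCommGroup E] [NormedSpace ℝ E]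
  [NormedAddCommGroup E'] [NormedSpace ℝ E']

/-- The iterated directional derivative `∂_{v₁} ⋯ ∂_{vₙ} f` along a list of vectors. -/
noncomputable def dirDeriv : List E → (E → ℝ) → E → ℝ
  | [], f => f
  | v :: vs, f => fun x => fderiv ℝ (dirDeriv vs f) x v

theorem dirDeriv_append (vs ws : List E) (f : E → ℝ) :
    dirDeriv (vs ++ ws) f = dirDeriv vs (dirDeriv ws f) := by
  induction vs with
  | nil => rfl
  | cons v vs ih => simp only [List.cons_append, dirDeriv, ih]

theorem contDiffOn_fderiv_apply {f : E → ℝ} {U : Set E} (hU : IsOpen U)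
    (hf : ContDiffOn ℝ (⊤ : ℕ∞) f U) (v : E) :
    ContDiffOn ℝ (⊤ : ℕ∞) (fun x => fderiv ℝ f x v) U :=
  ((contDiffOn_infty_iff_fderiv_of_isOpen hU).1 hf).2.clm_apply contDiffOn_const

theorem contDiffOn_dirDeriv {f : E → ℝ} {U : Set E} (hU : IsOpen U)
    (hf : ContDiffOn ℝ (⊤ : ℕ∞) f U) (vs : List E) :
    ContDiffOn ℝ (⊤ : ℕ∞) (dirDeriv vs f) U := by
  induction vs with
  | nil => exact hf
  | cons v vs ih => exact contDiffOn_fderiv_apply hU ih v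

theorem differentiableAt_dirDeriv {f : E → ℝ} {U : Set E} (hU : IsOpen U)
    (hf : ContDiffOn ℝ (⊤ : ℕ∞) f U) (vs : List E) {x : E} (hx : x ∈ U) :
    DifferentiableAt ℝ (dirDeriv vs f) x :=
  ((contDiffOn_dirDeriv hU hf vs).differentiableOn (by simp)).differentiableAt (hU.mem_nhds hx)

theorem dirDeriv_congr {f g : E → ℝ} {U : Set E} (hU : IsOpen U) (h : Set.EqOn f g U)
    (vs : List E) : Set.EqOn (dirDeriv vs f) (dirDeriv vs g) U := by
  induction vs with
  | nil => exact h
  | cons v vs ih =>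
    intro x hx
    simp only [dirDeriv]
    rw [(ih.eventuallyEq_of_mem (hU.mem_nhds hx)).fderiv_eq]

theorem dirDeriv_add {f g : E → ℝ} {U : Set E} (hU : IsOpen U)
    (hf : ContDiffOn ℝ (⊤ : ℕ∞) f U) (hg : ContDiffOn ℝ (⊤ : ℕ∞) g U) (vs : List E) :
    Set.EqOn (dirDeriv vs (f + g)) (dirDeriv vs f + dirDeriv vs g) U := by
  induction vs with
  | nil => exact fun _ _ => rfl
  | cons v vs ih =>
    intro x hx
    simp only [dirDeriv, Pi.add_apply]
    rw [(ih.eventuallyEq_of_mem (hU.mem_nhds hx)).fderiv_eq,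
      fderiv_add (differentiableAt_dirDeriv hU hf vs hx) (differentiableAt_dirDeriv hU hg vs hx)]
    rfl

theorem dirDeriv_const_smul (c : ℝ) (f : E → ℝ) (vs : List E) :
    dirDeriv vs (c • f) = c • dirDeriv vs f := by
  induction vs with
  | nil => rfl
  | cons v vs ih =>
    ext x
    simp only [dirDeriv, ih, Pi.smul_apply]
    rw [fderiv_const_smul_field]
    rfl

theorem dirDeriv_map_smul {ι : Type*} (c : ι → ℝ) (d : ι → E) (f : E → ℝ) (L : List ι) :
    dirDeriv (L.map fun i => c i • d i) f = (L.map c).prod • dirDeriv (L.map d) f := by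
  induction L with
  | nil => simp [dirDeriv]
  | cons i L ih =>
    ext x
    simp only [List.map_cons, List.prod_cons, dirDeriv, ih, Pi.smul_apply]
    rw [fderiv_const_smul_field]
    simp [mul_assoc]

theorem dirDeriv_comp_clm {f : E → ℝ} {U : Set E} (hU : IsOpen U)
    (hf : ContDiffOn ℝ (⊤ : ℕ∞) f U) (A : E' →L[ℝ] E) (vs : List E') :
    Set.EqOn (dirDeriv vs (f ∘ A)) (dirDeriv (vs.map A) f ∘ A) (A ⁻¹' U) := by
  induction vs with
  | nil => exact fun _ _ => rfl
  | cons v vs ih =>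
    intro x hx
    simp only [dirDeriv, List.map_cons, Function.comp_apply]
    rw [(ih.eventuallyEq_of_mem ((hU.preimage A.continuous).mem_nhds hx)).fderiv_eq,
      fderiv_comp _ (differentiableAt_dirDeriv hU hf _ hx) A.differentiableAt]
    simp

/-- Adjacent swaps reduce to symmetry of the second derivative. This is what makes the order of
cumulant entries irrelevant. -/
theorem dirDeriv_perm {f : E → ℝ} {U : Set E} (hU : IsOpen U)
    (hf : ContDiffOn ℝ (⊤ : ℕ∞) f U) {vs ws : List E} (h : vs.Perm ws) :
    Set.EqOn (dirDeriv vs f) (dirDeriv ws f) U := by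
  induction h with
  | nil => exact fun _ _ => rfl
  | cons v _ ih => exact dirDeriv_congr hU ih [v]
  | trans _ _ h₁ h₂ => exact h₁.trans h₂
  | swap v w vs =>
    intro x hx
    have hg := contDiffOn_dirDeriv hU hf vs
    have hd : DifferentiableAt ℝ (fderiv ℝ (dirDeriv vs f)) x :=
      (((contDiffOn_infty_iff_fderiv_of_isOpen hU).1 hg).2.differentiableOn
        (by simp)).differentiableAt (hU.mem_nhds hx)
    have hs : IsSymmSndFDerivAt ℝ (dirDeriv vs f) x :=
      (hg.contDiffAt (hU.mem_nhds hx)).isSymmSndFDerivAt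
        (by simpa using WithTop.coe_le_coe.2 (le_top : (2 : ℕ∞) ≤ ⊤))
    simp only [dirDeriv]
    rw [fderiv_clm_apply hd (differentiableAt_const _),
      fderiv_clm_apply hd (differentiableAt_const _)]
    simpa using hs w v

theorem iteratedFDeriv_eq_dirDeriv {f : E → ℝ} {U : Set E} (hU : IsOpen U)
    (hf : ContDiffOn ℝ (⊤ : ℕ∞) f U) (n : ℕ) (v : Fin n → E) {x : E} (hx : x ∈ U) :
    iteratedFDeriv ℝ n f x v = dirDeriv (List.ofFn v) f x := by
  induction n generalizing x with
  | zero => simp [dirDeriv]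
  | succ n ih =>
    rw [iteratedFDeriv_succ_apply_left, List.ofFn_succ]
    simp only [dirDeriv]
    have hd : DifferentiableAt ℝ (iteratedFDeriv ℝ n f) x :=
      (hf.contDiffAt (hU.mem_nhds hx)).differentiableAt_iteratedFDeriv
        (mod_cast WithTop.coe_lt_top _)
    have h : Set.EqOn (dirDeriv (List.ofFn fun i => v i.succ) f)
        (fun y => iteratedFDeriv ℝ n f y (Fin.tail v)) U := fun y hy => (ih _ hy).symm
    rw [(h.eventuallyEq_of_mem (hU.mem_nhds hx)).fderiv_eq,
      fderiv_continuousMultilinear_apply_const_apply hd]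

/-- Lines through a point of `S` in a direction of `S` stay in `S`, so the derivative only sees
zeros. -/
theorem dirDeriv_eq_zero_of_submodule {f : E → ℝ} {U : Set E} (hU : IsOpen U)
    (S : Submodule ℝ E) (hf : ∀ x ∈ U, x ∈ S → f x = 0) {vs : List E} (hvs : ∀ v ∈ vs, v ∈ S)
    {x : E} (hx : x ∈ U) (hxS : x ∈ S) : dirDeriv vs f x = 0 := by
  induction vs generalizing x with
  | nil => exact hf x hx hxS
  | cons v vs ih =>
    simp only [List.mem_cons, forall_eq_or_imp] at hvs
    simp only [dirDeriv]
    by_cases hd : DifferentiableAt ℝ (dirDeriv vs f) x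
    · rw [← hd.lineDeriv_eq_fderiv, lineDeriv]
      have hmem : ∀ᶠ t : ℝ in nhds 0, x + t • v ∈ U := by
        have hc : Continuous fun t : ℝ => x + t • v := by fun_prop
        exact hc.continuousAt.eventually_mem (hU.mem_nhds (by simpa using hx))
      have : (fun t : ℝ => dirDeriv vs f (x + t • v)) =ᶠ[nhds 0] fun _ => 0 :=
        hmem.mono fun t ht => ih hvs.2 ht (S.add_mem hxS (S.smul_mem t hvs.1))
      rw [this.deriv_eq, deriv_const]
    -- The default value `0` of `fderiv` spares any smoothness assumption on `f`.
    · rw [fderiv_zero_of_not_differentiableAt hd]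
      rfl

end DirectionalDerivatives

/-! ### Smoothness of weighted Laplace transforms -/

section LaplaceTransform

variable {Ω E : Type*} {mΩ : MeasurableSpace Ω} [NormedAddCommGroup E] [NormedSpace ℝ E]

/-- Random weights that are dominated by `exp (ε ‖ℓ‖)` for every `ε > 0`. -/
def SubexponentialWeight (μ : Measure Ω) (ℓ : Ω → E →L[ℝ] ℝ) (h : Ω → ℝ) : Prop :=
  AEStronglyMeasurable h μ ∧ ∀ ε > 0, ∃ C, ∀ ω, |h ω| ≤ C * Real.exp (ε * ‖ℓ ω‖)

/-- The weighted Laplace transform `t ↦ ∫ h exp (ℓ t)` of a random linear form `ℓ`. -/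
noncomputable def weightedLaplace (μ : Measure Ω) (ℓ : Ω → E →L[ℝ] ℝ) (h : Ω → ℝ) (t : E) : ℝ :=
  ∫ ω, h ω * Real.exp (ℓ ω t) ∂μ

variable {μ : Measure Ω} {ℓ : Ω → E →L[ℝ] ℝ} {h : Ω → ℝ} {r : ℝ}

theorem SubexponentialWeight.one : SubexponentialWeight μ ℓ 1 := by
  refine ⟨aestronglyMeasurable_const, fun ε hε => ⟨1, fun ω => ?_⟩⟩
  simp only [Pi.one_apply, abs_one, one_mul]
  exact Real.one_le_exp (by positivity)

theorem le_inv_mul_exp {ε : ℝ} (hε : 0 < ε) (x : ℝ) : x ≤ ε⁻¹ * Real.exp (ε * x) := by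
  rw [inv_mul_eq_div, le_div_iff₀ hε]
  linarith [Real.add_one_le_exp (ε * x)]

theorem SubexponentialWeight.mul_norm_bound (hh : SubexponentialWeight μ ℓ h) {ε : ℝ}
    (hε : 0 < ε) : ∃ C, 0 ≤ C ∧ ∀ ω, |h ω| * ‖ℓ ω‖ ≤ C * Real.exp (ε * ‖ℓ ω‖) := by
  obtain ⟨C, hC⟩ := hh.2 (ε / 2) (half_pos hε)
  refine ⟨|C| * (ε / 2)⁻¹, by positivity, fun ω => ?_⟩
  calc |h ω| * ‖ℓ ω‖
      ≤ (|C| * Real.exp (ε / 2 * ‖ℓ ω‖)) * ((ε / 2)⁻¹ * Real.exp (ε / 2 * ‖ℓ ω‖)) := by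
        gcongr
        · exact (hC ω).trans (by gcongr; exact le_abs_self C)
        · exact le_inv_mul_exp (half_pos hε) _
    _ = |C| * (ε / 2)⁻¹ * (Real.exp (ε / 2 * ‖ℓ ω‖) * Real.exp (ε / 2 * ‖ℓ ω‖)) := by ring
    _ = |C| * (ε / 2)⁻¹ * Real.exp (ε * ‖ℓ ω‖) := by rw [← Real.exp_add]; ring_nf

/-- Differentiating under the integral along `v` multiplies the weight by `ℓ v`; closure under this
operation drives the induction on the order of smoothness. -/
theorem SubexponentialWeight.mul_apply (hℓ : AEStronglyMeasurable ℓ μ)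
    (hh : SubexponentialWeight μ ℓ h) (v : E) :
    SubexponentialWeight μ ℓ (fun ω => h ω * ℓ ω v) := by
  refine ⟨hh.1.mul (hℓ.apply_continuousLinearMap v), fun ε hε => ?_⟩
  obtain ⟨C, -, hC⟩ := hh.mul_norm_bound hε
  refine ⟨C * ‖v‖, fun ω => ?_⟩
  calc |h ω * ℓ ω v| = |h ω| * ‖ℓ ω v‖ := abs_mul _ _
    _ ≤ |h ω| * (‖ℓ ω‖ * ‖v‖) := by gcongr; exact (ℓ ω).le_opNorm v
    _ = (|h ω| * ‖ℓ ω‖) * ‖v‖ := by ring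
    _ ≤ (C * Real.exp (ε * ‖ℓ ω‖)) * ‖v‖ :=
        mul_le_mul_of_nonneg_right (hC ω) (norm_nonneg v)
    _ = C * ‖v‖ * Real.exp (ε * ‖ℓ ω‖) := by ring

theorem exp_apply_le (L : E →L[ℝ] ℝ) {t : E} {s : ℝ} (ht : ‖t‖ ≤ s) :
    Real.exp (L t) ≤ Real.exp (s * ‖L‖) := by
  gcongr
  calc L t ≤ ‖L t‖ := le_abs_self _
    _ ≤ ‖L‖ * ‖t‖ := L.le_opNorm t
    _ ≤ ‖L‖ * s := by gcongr
    _ = s * ‖L‖ := mul_comm _ _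

theorem SubexponentialWeight.aestronglyMeasurable_mul_exp (hℓ : AEStronglyMeasurable ℓ μ)
    (hh : SubexponentialWeight μ ℓ h) (t : E) :
    AEStronglyMeasurable (fun ω => h ω * Real.exp (ℓ ω t)) μ :=
  hh.1.mul (Real.continuous_exp.comp_aestronglyMeasurable (hℓ.apply_continuousLinearMap t))

theorem SubexponentialWeight.integrable_mul_exp (hℓ : AEStronglyMeasurable ℓ μ)
    (hr : Integrable (fun ω => Real.exp (r * ‖ℓ ω‖)) μ)
    (hh : SubexponentialWeight μ ℓ h) {t : E} (ht : t ∈ Metric.ball (0 : E) r) :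
    Integrable (fun ω => h ω * Real.exp (ℓ ω t)) μ := by
  rw [mem_ball_zero_iff] at ht
  obtain ⟨C, hC⟩ := hh.2 (r - ‖t‖) (by linarith)
  refine (hr.const_mul C).mono' (hh.aestronglyMeasurable_mul_exp hℓ t) (.of_forall fun ω => ?_)
  rw [norm_mul, Real.norm_eq_abs, Real.norm_eq_abs, Real.abs_exp]
  calc |h ω| * Real.exp (ℓ ω t)
      ≤ C * Real.exp ((r - ‖t‖) * ‖ℓ ω‖) * Real.exp (‖t‖ * ‖ℓ ω‖) :=
        mul_le_mul (hC ω) (exp_apply_le _ le_rfl) (Real.exp_nonneg _)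
          ((abs_nonneg _).trans (hC ω))
    _ = C * Real.exp (r * ‖ℓ ω‖) := by rw [mul_assoc, ← Real.exp_add]; ring_nf

theorem SubexponentialWeight.hasFDerivAt_weightedLaplace (hℓ : AEStronglyMeasurable ℓ μ)
    (hr : Integrable (fun ω => Real.exp (r * ‖ℓ ω‖)) μ)
    (hh : SubexponentialWeight μ ℓ h) {t : E} (ht : t ∈ Metric.ball (0 : E) r) :
    Integrable (fun ω => (h ω * Real.exp (ℓ ω t)) • ℓ ω) μ ∧
    HasFDerivAt (weightedLaplace μ ℓ h) (∫ ω, (h ω * Real.exp (ℓ ω t)) • ℓ ω ∂μ) t := by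
  have ht' := ht
  rw [mem_ball_zero_iff] at ht'
  -- On the ball of radius `s` the exponential costs at most `exp (s * ‖ℓ‖)`, and the gap `r - s`
  -- absorbs the weight and the factor `‖ℓ‖`, so one dominating function serves the whole ball.
  obtain ⟨s, hts, hsr⟩ := exists_between ht'
  obtain ⟨C, hC0, hC⟩ := hh.mul_norm_bound (ε := r - s) (by linarith)
  have hmeas : AEStronglyMeasurable (fun ω => (h ω * Real.exp (ℓ ω t)) • ℓ ω) μ :=
    (hh.aestronglyMeasurable_mul_exp hℓ t).smul hℓ
  have hbound : ∀ ω, ∀ u ∈ Metric.ball (0 : E) s,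
      ‖(h ω * Real.exp (ℓ ω u)) • ℓ ω‖ ≤ C * Real.exp (r * ‖ℓ ω‖) := by
    intro ω u hu
    rw [mem_ball_zero_iff] at hu
    rw [norm_smul, norm_mul, Real.norm_eq_abs, Real.norm_eq_abs, Real.abs_exp]
    calc |h ω| * Real.exp (ℓ ω u) * ‖ℓ ω‖ = (|h ω| * ‖ℓ ω‖) * Real.exp (ℓ ω u) := by ring
      _ ≤ (C * Real.exp ((r - s) * ‖ℓ ω‖)) * Real.exp (s * ‖ℓ ω‖) :=
        mul_le_mul (hC ω) (exp_apply_le _ hu.le) (Real.exp_nonneg _) (by positivity)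
      _ = C * Real.exp (r * ‖ℓ ω‖) := by rw [mul_assoc, ← Real.exp_add]; ring_nf
  have hts' : t ∈ Metric.ball (0 : E) s := by rwa [mem_ball_zero_iff]
  refine ⟨(hr.const_mul C).mono' hmeas (.of_forall fun ω => hbound ω t hts'), ?_⟩
  refine hasFDerivAt_integral_of_dominated_of_fderiv_le (Metric.isOpen_ball.mem_nhds hts')
    (.of_forall fun u => hh.aestronglyMeasurable_mul_exp hℓ u)
    (hh.integrable_mul_exp hℓ hr ht) (F' := fun u ω => (h ω * Real.exp (ℓ ω u)) • ℓ ω)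
    hmeas (.of_forall hbound) (hr.const_mul C) (.of_forall fun ω u _ => ?_)
  rw [mul_smul]
  exact ((ℓ ω).hasFDerivAt.exp).const_mul (h ω)

theorem SubexponentialWeight.fderiv_weightedLaplace_apply (hℓ : AEStronglyMeasurable ℓ μ)
    (hr : Integrable (fun ω => Real.exp (r * ‖ℓ ω‖)) μ)
    (hh : SubexponentialWeight μ ℓ h) {t : E} (ht : t ∈ Metric.ball (0 : E) r) (v : E) :
    fderiv ℝ (weightedLaplace μ ℓ h) t v = weightedLaplace μ ℓ (fun ω => h ω * ℓ ω v) t := by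
  obtain ⟨hi, hd⟩ := hh.hasFDerivAt_weightedLaplace hℓ hr ht
  rw [hd.fderiv, ContinuousLinearMap.integral_apply hi]
  refine integral_congr_ae (.of_forall fun ω => ?_)
  simp only [FunLike.coe_smul, Pi.smul_apply, smul_eq_mul]
  ring

theorem SubexponentialWeight.contDiffOn_weightedLaplace [FiniteDimensional ℝ E]
    (hℓ : AEStronglyMeasurable ℓ μ) (hr : Integrable (fun ω => Real.exp (r * ‖ℓ ω‖)) μ)
    (hh : SubexponentialWeight μ ℓ h) :
    ContDiffOn ℝ (⊤ : ℕ∞) (weightedLaplace μ ℓ h) (Metric.ball 0 r) := by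
  rw [contDiffOn_infty]
  intro n
  induction n generalizing h with
  | zero =>
    exact contDiffOn_zero.2 fun t ht =>
      (hh.hasFDerivAt_weightedLaplace hℓ hr ht).2.continuousAt.continuousWithinAt
  | succ n ih =>
    push_cast
    rw [contDiffOn_succ_iff_fderiv_of_isOpen Metric.isOpen_ball]
    refine ⟨fun t ht =>
      (hh.hasFDerivAt_weightedLaplace hℓ hr ht).2.differentiableAt.differentiableWithinAt,
      by simp, contDiffOn_clm_apply.2 fun v => (ih (hh.mul_apply hℓ v)).congr fun t ht =>
        hh.fderiv_weightedLaplace_apply hℓ hr ht v⟩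

end LaplaceTransform

/-! ### Linear and quadratic monomials of a Gaussian vector -/

section GaussianLaplace

variable {I : Type*} [Fintype I]

/-- The inhomogeneous quadratic form `∑ sᵢ xᵢ + ∑ qᵢⱼ xᵢ xⱼ`, as a linear form in its
coefficients `(s, q)`. -/
noncomputable def linQuadForm (x : I → ℝ) : ((I → ℝ) × (I × I → ℝ)) →L[ℝ] ℝ :=
  ∑ i, x i • (ContinuousLinearMap.proj i ∘L ContinuousLinearMap.fst ℝ (I → ℝ) (I × I → ℝ)) +
    ∑ p : I × I, (x p.1 * x p.2) •
      (ContinuousLinearMap.proj p ∘L ContinuousLinearMap.snd ℝ (I → ℝ) (I × I → ℝ))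

theorem linQuadForm_apply (x : I → ℝ) (t : (I → ℝ) × (I × I → ℝ)) :
    linQuadForm x t = ∑ i, x i * t.1 i + ∑ p : I × I, x p.1 * x p.2 * t.2 p := by
  simp [linQuadForm]

theorem continuous_linQuadForm : Continuous (linQuadForm : (I → ℝ) → _) := by
  unfold linQuadForm
  fun_prop

theorem exists_norm_linQuadForm_le :
    ∃ K, 0 < K ∧ ∀ x : I → ℝ, ‖linQuadForm x‖ ≤ K * (1 + ‖x‖ ^ 2) := by
  let a (i : I) : ((I → ℝ) × (I × I → ℝ)) →L[ℝ] ℝ :=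
    ContinuousLinearMap.proj i ∘L ContinuousLinearMap.fst ℝ (I → ℝ) (I × I → ℝ)
  let b (p : I × I) : ((I → ℝ) × (I × I → ℝ)) →L[ℝ] ℝ :=
    ContinuousLinearMap.proj p ∘L ContinuousLinearMap.snd ℝ (I → ℝ) (I × I → ℝ)
  -- The summand `1` keeps the constant positive even when `I` is empty.
  refine ⟨∑ i, ‖a i‖ + ∑ p, ‖b p‖ + 1, by positivity, fun x => ?_⟩
  have h1 : ∀ i, |x i| ≤ ‖x‖ := norm_le_pi_norm x
  have h2 : ‖x‖ ≤ 1 + ‖x‖ ^ 2 := by nlinarith [sq_nonneg (‖x‖ - 1)]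
  calc ‖linQuadForm x‖ ≤ ‖∑ i, x i • a i‖ + ‖∑ p : I × I, (x p.1 * x p.2) • b p‖ :=
        norm_add_le _ _
    _ ≤ ∑ i, (1 + ‖x‖ ^ 2) * ‖a i‖ + ∑ p, (1 + ‖x‖ ^ 2) * ‖b p‖ := by
        refine add_le_add (norm_sum_le_of_le _ fun i _ => ?_) (norm_sum_le_of_le _ fun p _ => ?_)
        · rw [norm_smul]
          gcongr
          exact (h1 i).trans h2
        · rw [norm_smul, norm_mul]
          gcongr
          calc |x p.1| * |x p.2| ≤ ‖x‖ * ‖x‖ := by gcongr <;> exact h1 _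
            _ ≤ 1 + ‖x‖ ^ 2 := by nlinarith
    _ = (∑ i, ‖a i‖ + ∑ p, ‖b p‖) * (1 + ‖x‖ ^ 2) := by
        rw [← Finset.mul_sum, ← Finset.mul_sum]
        ring
    _ ≤ (∑ i, ‖a i‖ + ∑ p, ‖b p‖ + 1) * (1 + ‖x‖ ^ 2) := by
        exact mul_le_mul_of_nonneg_right (by linarith) (by positivity)

/-- Fernique's theorem integrates `exp (C * ‖x‖ ^ 2)`, and the form grows at most quadratically, so
`r = C / K` suffices. -/
theorem exists_integrable_exp_norm_linQuadForm (μ : Measure (I → ℝ)) [IsGaussian μ] :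
    ∃ r > 0, Integrable (fun x : I → ℝ => Real.exp (r * ‖linQuadForm x‖)) μ := by
  obtain ⟨C, hC, hint⟩ := IsGaussian.exists_integrable_exp_sq μ
  obtain ⟨K, hK, hle⟩ := exists_norm_linQuadForm_le (I := I)
  refine ⟨C / K, by positivity, (hint.const_mul (Real.exp C)).mono' ?_ (.of_forall fun x => ?_)⟩
  · exact (Real.continuous_exp.comp
      ((continuous_linQuadForm (I := I)).norm.const_mul (C / K))).aestronglyMeasurable
  · rw [Real.norm_eq_abs, Real.abs_exp, ← Real.exp_add]
    gcongr
    calc C / K * ‖linQuadForm x‖ ≤ C / K * (K * (1 + ‖x‖ ^ 2)) := by gcongr; exact hle x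
      _ = C + C * ‖x‖ ^ 2 := by field_simp

/-- Multiplication of the linear coefficients by a constant. -/
noncomputable def scaleLinear (I : Type*) (c : ℝ) :
    ((I → ℝ) × (I × I → ℝ)) →L[ℝ] ((I → ℝ) × (I × I → ℝ)) :=
  (c • ContinuousLinearMap.id ℝ (I → ℝ)).prodMap (ContinuousLinearMap.id ℝ (I × I → ℝ))

theorem scaleLinear_apply {I : Type*} (c : ℝ) (t : (I → ℝ) × (I × I → ℝ)) :
    scaleLinear I c t = (c • t.1, t.2) := rfl

/-- The moment-generating function of all linear and quadratic monomials. -/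
noncomputable def linQuadMGF (μ : Measure (I → ℝ)) (t : (I → ℝ) × (I × I → ℝ)) : ℝ :=
  ∫ x, Real.exp (linQuadForm x t) ∂μ

/-- The cumulant-generating function of all linear and quadratic monomials. -/
noncomputable def linQuadCGF (μ : Measure (I → ℝ)) (t : (I → ℝ) × (I × I → ℝ)) : ℝ :=
  Real.log (linQuadMGF μ t)

theorem linQuadMGF_eq_weightedLaplace (μ : Measure (I → ℝ)) :
    linQuadMGF μ = weightedLaplace μ linQuadForm 1 := by
  ext t
  simp [linQuadMGF, weightedLaplace]

/-- Under the rotation by π/4, √2 times the first coordinate becomes x + y, while q(x, x) + q(y, y)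
is unchanged because the cross terms cancel. -/
theorem linQuadMGF_sq (μ : Measure (I → ℝ)) [IsGaussian μ] (hμ : μ[id] = 0)
    (t : (I → ℝ) × (I × I → ℝ)) :
    linQuadMGF μ t * linQuadMGF μ t =
      linQuadMGF μ (scaleLinear I (√2) t) * linQuadMGF μ (scaleLinear I 0 t) := by
  simp only [linQuadMGF]
  rw [← integral_prod_mul, ← integral_prod_mul]
  conv_rhs => rw [← IsGaussian.map_rotation_eq_self hμ (Real.pi / 4)]
  have hc : Continuous fun z : (I → ℝ) × (I → ℝ) =>
      Real.exp (linQuadForm z.1 (scaleLinear I (√2) t)) *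
        Real.exp (linQuadForm z.2 (scaleLinear I 0 t)) := by
    have := continuous_linQuadForm (I := I)
    fun_prop
  rw [integral_map (by fun_prop) hc.aestronglyMeasurable]
  refine integral_congr_ae (.of_forall fun z => ?_)
  have h2 : √2 * √2 = 2 := Real.mul_self_sqrt (by norm_num)
  simp only [← Real.exp_add, ContinuousLinearMap.rotation_apply, linQuadForm_apply,
    scaleLinear_apply, Real.cos_pi_div_four, Real.sin_pi_div_four, Pi.add_apply, Pi.smul_apply,
    smul_eq_mul, zero_mul, mul_zero, Finset.sum_const_zero, zero_add]
  congr 1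
  have e1 : ∀ i, (√2 / 2 * z.1 i + √2 / 2 * z.2 i) * (√2 * t.1 i) =
      z.1 i * t.1 i + z.2 i * t.1 i := fun i => by linear_combination (z.1 i + z.2 i) * t.1 i / 2 * h2
  have e2 : ∀ p : I × I, (√2 / 2 * z.1 p.1 + √2 / 2 * z.2 p.1) *
      (√2 / 2 * z.1 p.2 + √2 / 2 * z.2 p.2) * t.2 p +
      (-(√2 / 2) * z.1 p.1 + √2 / 2 * z.2 p.1) *
      (-(√2 / 2) * z.1 p.2 + √2 / 2 * z.2 p.2) * t.2 p =
      z.1 p.1 * z.1 p.2 * t.2 p + z.2 p.1 * z.2 p.2 * t.2 p := fun p => by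
    linear_combination (z.1 p.1 * z.1 p.2 + z.2 p.1 * z.2 p.2) * t.2 p / 2 * h2
  rw [add_assoc (∑ i, (√2 / 2 * z.1 i + _) * _), ← Finset.sum_add_distrib]
  simp only [e1, e2, Finset.sum_add_distrib]
  ring

variable {μ : Measure (I → ℝ)} {r : ℝ}

theorem integrable_exp_linQuadForm (hr : Integrable (fun x : I → ℝ => Real.exp (r * ‖linQuadForm x‖)) μ)
    {t : (I → ℝ) × (I × I → ℝ)} (ht : t ∈ Metric.ball 0 r) :
    Integrable (fun x => Real.exp (linQuadForm x t)) μ := by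
  simpa using SubexponentialWeight.one.integrable_mul_exp
    continuous_linQuadForm.aestronglyMeasurable hr ht

theorem linQuadMGF_pos [IsGaussian μ] (hr : Integrable (fun x : I → ℝ => Real.exp (r * ‖linQuadForm x‖)) μ)
    {t : (I → ℝ) × (I × I → ℝ)} (ht : t ∈ Metric.ball 0 r) : 0 < linQuadMGF μ t :=
  integral_exp_pos (integrable_exp_linQuadForm hr ht)

theorem contDiffOn_linQuadMGF (hr : Integrable (fun x : I → ℝ => Real.exp (r * ‖linQuadForm x‖)) μ) :
    ContDiffOn ℝ (⊤ : ℕ∞) (linQuadMGF μ) (Metric.ball 0 r) := by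
  rw [linQuadMGF_eq_weightedLaplace]
  exact SubexponentialWeight.one.contDiffOn_weightedLaplace
    continuous_linQuadForm.aestronglyMeasurable hr

theorem contDiffOn_linQuadCGF [IsGaussian μ] (hr : Integrable (fun x : I → ℝ => Real.exp (r * ‖linQuadForm x‖)) μ) :
    ContDiffOn ℝ (⊤ : ℕ∞) (linQuadCGF μ) (Metric.ball 0 r) :=
  (contDiffOn_linQuadMGF hr).log fun _ ht => (linQuadMGF_pos hr ht).ne'

theorem two_smul_linQuadCGF [IsGaussian μ] (hμ : μ[id] = 0)
    (hr : Integrable (fun x : I → ℝ => Real.exp (r * ‖linQuadForm x‖)) μ)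
    {t : (I → ℝ) × (I × I → ℝ)} (hs : scaleLinear I (√2) t ∈ Metric.ball 0 r)
    (hz : scaleLinear I 0 t ∈ Metric.ball 0 r) :
    linQuadCGF μ (scaleLinear I (√2) t) + linQuadCGF μ (scaleLinear I 0 t) =
      2 * linQuadCGF μ t := by
  simp only [linQuadCGF]
  rw [← Real.log_mul (linQuadMGF_pos hr hs).ne' (linQuadMGF_pos hr hz).ne', ← linQuadMGF_sq μ hμ,
    ← sq, Real.log_pow]
  simp

/-- A dilation of the linear coefficients multiplies a derivative in `p` linear directions by the
`p`-th power of the ratio. Here `d i` is a linear direction if `c i`, a quadratic one otherwise. -/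
theorem dirDeriv_linQuadCGF_comp_scaleLinear [IsGaussian μ]
    (hr : Integrable (fun x : I → ℝ => Real.exp (r * ‖linQuadForm x‖)) μ) {ι : Type*} (c : ι → Bool)
    (d : ι → (I → ℝ) × (I × I → ℝ))
    (hd : ∀ i a, scaleLinear I a (d i) = (if c i then a else 1) • d i) (L : List ι) (a : ℝ)
    {t : (I → ℝ) × (I × I → ℝ)} (ht : t ∈ Metric.ball 0 r) (h0 : t.1 = 0) :
    dirDeriv (L.map d) (linQuadCGF μ ∘ scaleLinear I a) t =
      a ^ L.countP c * dirDeriv (L.map d) (linQuadCGF μ) t := by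
  -- Points with no linear part are fixed by every dilation, so both derivatives are taken at the
  -- same point.
  have hfix : scaleLinear I a t = t := by
    rw [scaleLinear_apply, h0, smul_zero, ← h0]
  rw [dirDeriv_comp_clm Metric.isOpen_ball (contDiffOn_linQuadCGF hr) _ _
    (by rwa [Set.mem_preimage, hfix])]
  have hmap : (L.map d).map (scaleLinear I a) = L.map fun i => (if c i then a else 1) • d i := by
    simp [hd]
  have hprod : (L.map fun i => if c i then a else 1).prod = a ^ L.countP c := by
    induction L with
    | nil => simp
    | cons i L ih =>
      by_cases h : c i <;> simp_all [pow_succ, mul_comm]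
  rw [hmap, dirDeriv_map_smul, hprod, Function.comp_apply, hfix]
  rfl

/-- With p linear directions the functional equation yields (√2^p + 0^p) D = 2D, and √2^p = 2 only
for p = 2. The point ranges over the whole subspace of zero linear part, as the two-singlet case
requires. -/
theorem dirDeriv_linQuadCGF_eq_zero [IsGaussian μ] (hμ : μ[id] = 0)
    (hr : Integrable (fun x : I → ℝ => Real.exp (r * ‖linQuadForm x‖)) μ) {ι : Type*} (c : ι → Bool)
    (d : ι → (I → ℝ) × (I × I → ℝ))
    (hd : ∀ i a, scaleLinear I a (d i) = (if c i then a else 1) • d i) {L : List ι}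
    (hL : L.countP c = 1 ∨ 2 < L.countP c)
    {t : (I → ℝ) × (I × I → ℝ)} (ht : t ∈ Metric.ball 0 r) (h0 : t.1 = 0) :
    dirDeriv (L.map d) (linQuadCGF μ) t = 0 := by
  set U : Set ((I → ℝ) × (I × I → ℝ)) := Metric.ball 0 r
  have hF : ContDiffOn ℝ (⊤ : ℕ∞) (linQuadCGF μ) U := contDiffOn_linQuadCGF hr
  let W := scaleLinear I (√2) ⁻¹' U ∩ scaleLinear I 0 ⁻¹' U
  have hopen (a : ℝ) : IsOpen (scaleLinear I a ⁻¹' U) :=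
    Metric.isOpen_ball.preimage (scaleLinear I a).continuous
  have hW : IsOpen W := (hopen _).inter (hopen _)
  have hfix (a : ℝ) : scaleLinear I a t = t := by
    rw [scaleLinear_apply, h0, smul_zero, ← h0]
  have htW : t ∈ W := by
    simp only [W, Set.mem_inter_iff, Set.mem_preimage, hfix]
    exact ⟨ht, ht⟩
  have hsmooth (a : ℝ) : ContDiffOn ℝ (⊤ : ℕ∞) (linQuadCGF μ ∘ scaleLinear I a)
      (scaleLinear I a ⁻¹' U) :=
    hF.comp (scaleLinear I a).contDiff.contDiffOn fun _ h => h
  have key : Set.EqOn (linQuadCGF μ ∘ scaleLinear I (√2) + linQuadCGF μ ∘ scaleLinear I 0)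
      ((2 : ℝ) • linQuadCGF μ) W := fun x hx => two_smul_linQuadCGF hμ hr hx.1 hx.2
  have h := dirDeriv_congr hW key (L.map d) htW
  rw [dirDeriv_add hW ((hsmooth _).mono Set.inter_subset_left)
    ((hsmooth _).mono Set.inter_subset_right) _ htW, dirDeriv_const_smul, Pi.add_apply,
    dirDeriv_linQuadCGF_comp_scaleLinear hr c d hd L _ ht h0,
    dirDeriv_linQuadCGF_comp_scaleLinear hr c d hd L _ ht h0, Pi.smul_apply, smul_eq_mul] at h
  have hs : 1 < √2 := by
    rw [Real.lt_sqrt] <;> norm_num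
  have h2 : √2 ^ 2 = 2 := Real.sq_sqrt (by norm_num)
  have hne : √2 ^ L.countP c ≠ 2 := by
    rcases hL with hL | hL
    · rw [hL, pow_one]
      nlinarith
    · exact ne_of_gt (by simpa [h2] using pow_lt_pow_right₀ hs hL)
  -- Here p ≥ 1 is essential: for p = 0 the term 0^0 = 1 makes the equation trivial.
  rw [zero_pow (by omega), zero_mul, add_zero] at h
  exact (mul_eq_mul_right_iff.1 h).resolve_left hne

/-- Both derivatives insert the same polynomial factor under the integral. -/
theorem dirDeriv_pair_linQuadMGF (hr : Integrable (fun x : I → ℝ => Real.exp (r * ‖linQuadForm x‖)) μ)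
    {u v w : (I → ℝ) × (I × I → ℝ)}
    (huv : ∀ x, linQuadForm x u * linQuadForm x v = linQuadForm x w) :
    Set.EqOn (dirDeriv [u, v] (linQuadMGF μ)) (dirDeriv [w] (linQuadMGF μ))
      (Metric.ball 0 r) := by
  intro t ht
  have hm : AEStronglyMeasurable linQuadForm μ :=
    continuous_linQuadForm.aestronglyMeasurable
  have h1 : SubexponentialWeight μ linQuadForm 1 := .one
  have hv : Set.EqOn (fun y => fderiv ℝ (linQuadMGF μ) y v)
      (weightedLaplace μ linQuadForm fun x => (1 : (I → ℝ) → ℝ) x * linQuadForm x v)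
      (Metric.ball 0 r) := fun y hy => by
    simp only [linQuadMGF_eq_weightedLaplace]
    exact h1.fderiv_weightedLaplace_apply hm hr hy v
  simp only [dirDeriv]
  rw [(hv.eventuallyEq_of_mem (Metric.isOpen_ball.mem_nhds ht)).fderiv_eq,
    (h1.mul_apply hm v).fderiv_weightedLaplace_apply hm hr ht u, linQuadMGF_eq_weightedLaplace,
    h1.fderiv_weightedLaplace_apply hm hr ht w]
  simp only [← huv, mul_assoc, mul_comm (linQuadForm _ v)]

theorem dirDeriv_pair_linQuadCGF [IsGaussian μ] (hr : Integrable (fun x : I → ℝ => Real.exp (r * ‖linQuadForm x‖)) μ)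
    {u v w : (I → ℝ) × (I × I → ℝ)}
    (huv : ∀ x, linQuadForm x u * linQuadForm x v = linQuadForm x w) :
    Set.EqOn (dirDeriv [w] (linQuadCGF μ))
      (dirDeriv [u, v] (linQuadCGF μ) + dirDeriv [u] (linQuadCGF μ) * dirDeriv [v] (linQuadCGF μ))
      (Metric.ball 0 r) := by
  intro t ht
  have hd (vs) {y} (hy : y ∈ Metric.ball 0 r) : DifferentiableAt ℝ (dirDeriv vs (linQuadMGF μ)) y :=
    differentiableAt_dirDeriv Metric.isOpen_ball (contDiffOn_linQuadMGF hr) vs hy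
  have hlog (v) : Set.EqOn (dirDeriv [v] (linQuadCGF μ))
      (fun y => dirDeriv [v] (linQuadMGF μ) y * (linQuadMGF μ y)⁻¹) (Metric.ball 0 r) := fun y hy => by
    have hl : HasFDerivAt (linQuadCGF μ) _ y :=
      (hd [] hy).hasFDerivAt.log (linQuadMGF_pos hr hy).ne'
    simp only [dirDeriv]
    rw [hl.fderiv]
    simp only [FunLike.coe_smul, Pi.smul_apply, smul_eq_mul, dirDeriv]
    ring
  have hM := (linQuadMGF_pos hr ht).ne'
  have hquot : dirDeriv [u, v] (linQuadCGF μ) t =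
      (dirDeriv [u, v] (linQuadMGF μ) t * linQuadMGF μ t -
        dirDeriv [v] (linQuadMGF μ) t * dirDeriv [u] (linQuadMGF μ) t) / linQuadMGF μ t ^ 2 := by
    have hi : HasFDerivAt (fun y => (linQuadMGF μ y)⁻¹)
        (-(linQuadMGF μ t ^ 2)⁻¹ • fderiv ℝ (linQuadMGF μ) t) t :=
      (hasDerivAt_inv hM).comp_hasFDerivAt t (hd [] ht).hasFDerivAt
    have hq := (hd [v] ht).hasFDerivAt.fun_mul hi
    change fderiv ℝ (dirDeriv [v] (linQuadCGF μ)) t u = _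
    rw [((hlog v).eventuallyEq_of_mem (Metric.isOpen_ball.mem_nhds ht)).fderiv_eq, hq.fderiv]
    simp only [FunLike.coe_smul, FunLike.coe_add, Pi.add_apply, Pi.smul_apply, smul_eq_mul,
      dirDeriv]
    field_simp
    ring
  rw [Pi.add_apply, Pi.mul_apply, hquot, hlog u ht, hlog v ht, hlog w ht]
  beta_reduce
  rw [← dirDeriv_pair_linQuadMGF hr huv ht]
  field_simp
  ring

/-- The two sides differ by derivatives of ∂ᵤF ∂ᵥF along `vs`. The factor ∂ᵤF vanishes near `0` on
the subspace of zero linear part, to which every vector of `vs` is tangent. -/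
theorem dirDeriv_linQuadCGF_append_pair [IsGaussian μ] (hμ : μ[id] = 0)
    (hr : Integrable (fun x : I → ℝ => Real.exp (r * ‖linQuadForm x‖)) μ) (hr0 : 0 < r)
    {u v w : (I → ℝ) × (I × I → ℝ)}
    (huv : ∀ x, linQuadForm x u * linQuadForm x v = linQuadForm x w)
    (hu : u.2 = 0) {vs : List ((I → ℝ) × (I × I → ℝ))} (hvs : ∀ z ∈ vs, z.1 = 0) :
    dirDeriv (vs ++ [u, v]) (linQuadCGF μ) 0 = dirDeriv (vs ++ [w]) (linQuadCGF μ) 0 := by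
  have h0 : (0 : (I → ℝ) × (I × I → ℝ)) ∈ Metric.ball 0 r := Metric.mem_ball_self hr0
  have hF := contDiffOn_linQuadCGF hr
  have hs (ws) := contDiffOn_dirDeriv Metric.isOpen_ball hF ws
  have hvanish : ∀ t ∈ Metric.ball (0 : (I → ℝ) × (I × I → ℝ)) r,
      t ∈ LinearMap.ker (LinearMap.fst ℝ (I → ℝ) (I × I → ℝ)) →
      (dirDeriv [u] (linQuadCGF μ) * dirDeriv [v] (linQuadCGF μ)) t = 0 := by
    intro t ht ht0
    have := dirDeriv_linQuadCGF_eq_zero hμ hr (fun _ : Unit => true) (fun _ => u)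
      (fun _ a => by simp [scaleLinear_apply, Prod.ext_iff, hu]) (L := [()]) (by simp) ht ht0
    simp only [List.map_cons, List.map_nil] at this
    rw [Pi.mul_apply, this, zero_mul]
  have hprod := (hs [u]).mul (hs [v])
  rw [dirDeriv_append, dirDeriv_append,
    dirDeriv_congr Metric.isOpen_ball (dirDeriv_pair_linQuadCGF hr huv) vs h0,
    dirDeriv_add Metric.isOpen_ball (hs _) (hprod : ContDiffOn ℝ _ (_ * _) _) vs h0, Pi.add_apply,
    dirDeriv_eq_zero_of_submodule Metric.isOpen_ball _ hvanish hvs h0 (Submodule.zero_mem _),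
    add_zero]

end GaussianLaplace

/-! ### Entries as coefficient directions -/

namespace CumulantEntry

variable {T Ω : Type*}

/-- The indices that occur in an entry. -/
def indices : CumulantEntry T → List T
  | singlet a => [a]
  | doublet a b => [a, b]

open Classical in
/-- The coefficient vector of the monomial denoted by an entry. -/
noncomputable def direction (I : Finset T) : CumulantEntry T → (I → ℝ) × (I × I → ℝ)
  | singlet a => (fun i => if i.1 = a then 1 else 0, 0)
  | doublet a b => (0, fun p => if p.1.1 = a ∧ p.2.1 = b then 1 else 0)

/-- Membership in `I` matters: an index outside it would make the direction zero. -/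
theorem linQuadForm_direction {I : Finset T} {e : CumulantEntry T} (he : ∀ a ∈ e.indices, a ∈ I)
    (x : T → ℝ) :
    linQuadForm (I.restrict x) (e.direction I) = e.toRV (fun a (y : T → ℝ) => y a) x := by
  classical
  cases e with
  | singlet a =>
    have ha : a ∈ I := he a (by simp [indices])
    rw [linQuadForm_apply, Finset.sum_eq_single (⟨a, ha⟩ : I)]
    · simp [direction, toRV]
    · intro i _ hi
      have : i.1 ≠ a := fun h => hi (Subtype.ext h)
      simp [direction, this]
    · simp
  | doublet a b =>
    have ha : a ∈ I := he a (by simp [indices])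
    have hb : b ∈ I := he b (by simp [indices])
    rw [linQuadForm_apply, Finset.sum_eq_single ((⟨a, ha⟩, ⟨b, hb⟩) : I × I)]
    · simp [direction, toRV]
    · intro p _ hp
      have : ¬(p.1.1 = a ∧ p.2.1 = b) := fun h =>
        hp (Prod.ext (Subtype.ext h.1) (Subtype.ext h.2))
      simp [direction, this]
    · simp

theorem scaleLinear_direction (I : Finset T) (e : CumulantEntry T) (c : ℝ) :
    scaleLinear I c (e.direction I) = (if e.isSinglet then c else 1) • e.direction I := by
  cases e <;> simp [direction, isSinglet, scaleLinear_apply]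

theorem exists_finset_indices (L : List (CumulantEntry T)) :
    ∃ I : Finset T, ∀ e ∈ L, ∀ a ∈ e.indices, a ∈ I := by
  classical
  refine ⟨(L.flatMap indices).toFinset, fun e he a ha => ?_⟩
  rw [List.mem_toFinset, List.mem_flatMap]
  exact ⟨e, he, ha⟩

end CumulantEntry

/-! ### Transfer to cumulants of the process -/

section MixedCumulants

variable {T Ω : Type*} {mΩ : MeasurableSpace Ω} {P : Measure Ω} {X : T → Ω → ℝ}

/-- The law of the variables with index in a finite set. -/
noncomputable def finiteLaw (P : Measure Ω) (X : T → Ω → ℝ) (I : Finset T) : Measure (I → ℝ) :=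
  P.map fun ω => I.restrict (X · ω)

theorem aemeasurable_restrict (hX : IsGaussianProcess X P) (I : Finset T) :
    AEMeasurable (fun ω => I.restrict (X · ω)) P :=
  aemeasurable_pi_lambda _ fun i => hX.aemeasurable i

theorem isGaussian_finiteLaw (hX : IsGaussianProcess X P) (I : Finset T) :
    IsGaussian (finiteLaw P X I) :=
  (hX.hasGaussianLaw I).isGaussian_map

theorem integral_id_finiteLaw (hX : IsGaussianProcess X P) (hmean : ∀ a, ∫ ω, X a ω ∂P = 0)
    (I : Finset T) : (finiteLaw P X I)[id] = 0 := by
  have := isGaussian_finiteLaw hX I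
  ext i
  calc (∫ x, id x ∂finiteLaw P X I) i = ∫ x, x i ∂finiteLaw P X I :=
        ((ContinuousLinearMap.proj (R := ℝ) (φ := fun _ : I => ℝ) i).integral_comp_comm
          (IsGaussian.integrable_id (μ := finiteLaw P X I))).symm
    _ = ∫ ω, X i ω ∂P :=
        integral_map (aemeasurable_restrict hX I) (measurable_pi_apply i).aestronglyMeasurable
    _ = 0 := hmean i

/-- The coefficients of the quadratic polynomial `∑ tₖ Yₖ`, where the `Yₖ` are the entries of a
list. -/
noncomputable def entryCoefficients (I : Finset T) (L : List (CumulantEntry T)) :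
    (Fin L.length → ℝ) →L[ℝ] (I → ℝ) × (I × I → ℝ) :=
  ∑ k, (ContinuousLinearMap.proj (R := ℝ) (φ := fun _ : Fin L.length => ℝ) k).smulRight
    ((L.get k).direction I)

theorem entryCoefficients_apply (I : Finset T) (L : List (CumulantEntry T))
    (t : Fin L.length → ℝ) :
    entryCoefficients I L t = ∑ k, t k • (L.get k).direction I := by
  simp [entryCoefficients]

theorem entryCoefficients_single (I : Finset T) (L : List (CumulantEntry T)) (k : Fin L.length) :
    entryCoefficients I L (Pi.single k 1) = (L.get k).direction I := by
  rw [entryCoefficients_apply, Finset.sum_eq_single k] <;> simp +contextual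

variable {I : Finset T} {L : List (CumulantEntry T)}

theorem sum_mul_entryFamily (hI : ∀ e ∈ L, ∀ a ∈ e.indices, a ∈ I) (t : Fin L.length → ℝ)
    (ω : Ω) : ∑ k, t k * entryFamily X L k ω =
      linQuadForm (I.restrict (X · ω)) (entryCoefficients I L t) := by
  rw [entryCoefficients_apply, map_sum]
  refine Finset.sum_congr rfl fun k _ => ?_
  rw [map_smul, CumulantEntry.linQuadForm_direction (hI _ (L.get_mem k)), smul_eq_mul]
  simp only [entryFamily]
  cases L.get k <;> rfl

theorem aestronglyMeasurable_exp_linQuadForm {μ : Measure (I → ℝ)}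
    (t : (I → ℝ) × (I × I → ℝ)) :
    AEStronglyMeasurable (fun x => Real.exp (linQuadForm x t)) μ := by
  have := continuous_linQuadForm (I := I)
  exact Continuous.aestronglyMeasurable (by fun_prop)

theorem jointCGF_entryFamily (hX : IsGaussianProcess X P)
    (hI : ∀ e ∈ L, ∀ a ∈ e.indices, a ∈ I) :
    jointCGF P (entryFamily X L) = linQuadCGF (finiteLaw P X I) ∘ entryCoefficients I L := by
  ext t
  simp only [jointCGF, jointMGF, linQuadCGF, linQuadMGF, Function.comp_apply, finiteLaw,
    sum_mul_entryFamily hI]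
  rw [integral_map (aemeasurable_restrict hX I) (aestronglyMeasurable_exp_linQuadForm _)]

theorem jointCumulantExists_entryFamily (hX : IsGaussianProcess X P)
    (L : List (CumulantEntry T)) : JointCumulantExists P (entryFamily X L) := by
  obtain ⟨I, hI⟩ := CumulantEntry.exists_finset_indices L
  have := isGaussian_finiteLaw hX I
  obtain ⟨r, hr0, hr⟩ := exists_integrable_exp_norm_linQuadForm (finiteLaw P X I)
  have hA := (entryCoefficients I L).continuous
  have hball : Metric.ball (0 : (I → ℝ) × (I × I → ℝ)) r ∈ nhds (entryCoefficients I L 0) := by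
    rw [map_zero]
    exact Metric.ball_mem_nhds _ hr0
  refine ⟨(hA.continuousAt.eventually_mem hball).mono fun t ht => ?_, ?_⟩
  · have := integrable_exp_linQuadForm hr ht
    simp only [sum_mul_entryFamily hI]
    exact (integrable_map_measure (aestronglyMeasurable_exp_linQuadForm _)
      (aemeasurable_restrict hX I)).1 this
  · rw [jointCGF_entryFamily hX hI]
    exact (((contDiffOn_linQuadCGF hr).contDiffAt hball).comp 0
      (entryCoefficients I L).contDiff.contDiffAt).of_le (mod_cast le_top)

/-- The cumulant-generating function of the entries is F composed with the linear map sending the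
k-th basis vector to the k-th direction; the chain rule does the rest. -/
theorem mixedCumulant_eq_dirDeriv (hX : IsGaussianProcess X P)
    (hI : ∀ e ∈ L, ∀ a ∈ e.indices, a ∈ I) {r : ℝ} (hr0 : 0 < r)
    (hr : Integrable (fun x : I → ℝ => Real.exp (r * ‖linQuadForm x‖)) (finiteLaw P X I)) :
    mixedCumulant P X L =
      dirDeriv (L.map (CumulantEntry.direction I)) (linQuadCGF (finiteLaw P X I)) 0 := by
  have := isGaussian_finiteLaw hX I
  have hF := contDiffOn_linQuadCGF hr
  have hU : IsOpen (entryCoefficients I L ⁻¹' Metric.ball 0 r) :=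
    Metric.isOpen_ball.preimage (entryCoefficients I L).continuous
  have h0 : (0 : Fin L.length → ℝ) ∈ entryCoefficients I L ⁻¹' Metric.ball 0 r := by
    simpa using hr0
  have hmap : (List.ofFn fun k : Fin L.length => (Pi.single k 1 : Fin L.length → ℝ)).map
      (entryCoefficients I L) = L.map (CumulantEntry.direction I) := by
    rw [List.map_ofFn]
    conv_rhs => rw [← List.ofFn_get L, List.map_ofFn]
    congr 1
    ext1 k
    exact entryCoefficients_single I L k
  rw [mixedCumulant, jointCumulant, jointCGF_entryFamily hX hI,
    iteratedFDeriv_eq_dirDeriv hU (hF.comp (entryCoefficients I L).contDiff.contDiffOn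
      fun _ h => h) _ _ h0, dirDeriv_comp_clm Metric.isOpen_ball hF _ _ h0, hmap,
    Function.comp_apply, map_zero]

theorem mixedCumulant_eq_zero (hX : IsGaussianProcess X P) (hmean : ∀ a, ∫ ω, X a ω ∂P = 0)
    (hL : L.countP CumulantEntry.isSinglet = 1 ∨ 2 < L.countP CumulantEntry.isSinglet) :
    mixedCumulant P X L = 0 := by
  obtain ⟨I, hI⟩ := CumulantEntry.exists_finset_indices L
  have := isGaussian_finiteLaw hX I
  obtain ⟨r, hr0, hr⟩ := exists_integrable_exp_norm_linQuadForm (finiteLaw P X I)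
  rw [mixedCumulant_eq_dirDeriv hX hI hr0 hr]
  exact dirDeriv_linQuadCGF_eq_zero (integral_id_finiteLaw hX hmean I) hr _ _
    (CumulantEntry.scaleLinear_direction I) hL (Metric.mem_ball_self hr0) rfl

theorem mixedCumulant_singlet_singlet (hX : IsGaussianProcess X P)
    (hmean : ∀ a, ∫ ω, X a ω ∂P = 0) (a b : T) (D : List (T × T))
    {L L' : List (CumulantEntry T)}
    (hL : L.Perm (.singlet a :: .singlet b :: D.map fun d => .doublet d.1 d.2))
    (hL' : L'.Perm (.doublet a b :: D.map fun d => .doublet d.1 d.2)) :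
    mixedCumulant P X L = mixedCumulant P X L' := by
  -- One index set for both lists, so that both cumulants are derivatives of the same function.
  obtain ⟨I, hI⟩ := CumulantEntry.exists_finset_indices (L ++ L')
  simp only [List.mem_append, or_imp, forall_and] at hI
  have := isGaussian_finiteLaw hX I
  obtain ⟨r, hr0, hr⟩ := exists_integrable_exp_norm_linQuadForm (finiteLaw P X I)
  have h0 : (0 : (I → ℝ) × (I × I → ℝ)) ∈ Metric.ball 0 r := Metric.mem_ball_self hr0
  have hF := contDiffOn_linQuadCGF hr
  have hab : ∀ c ∈ (CumulantEntry.doublet a b).indices, c ∈ I :=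
    hI.2 _ (hL'.mem_iff.2 List.mem_cons_self)
  have ha : a ∈ I := hab a (by simp [CumulantEntry.indices])
  have hb : b ∈ I := hab b (by simp [CumulantEntry.indices])
  set V := (D.map fun d => CumulantEntry.doublet d.1 d.2).map (CumulantEntry.direction I) with hV
  have hp : (L.map (CumulantEntry.direction I)).Perm
      (V ++ [(CumulantEntry.singlet a).direction I, (CumulantEntry.singlet b).direction I]) :=
    (hL.map _).trans (List.perm_append_comm (l₁ := [_, _]))
  have hp' : (L'.map (CumulantEntry.direction I)).Perm
      (V ++ [(CumulantEntry.doublet a b).direction I]) :=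
    (hL'.map _).trans (List.perm_append_comm (l₁ := [_]))
  rw [mixedCumulant_eq_dirDeriv hX hI.1 hr0 hr, mixedCumulant_eq_dirDeriv hX hI.2 hr0 hr,
    dirDeriv_perm Metric.isOpen_ball hF hp h0, dirDeriv_perm Metric.isOpen_ball hF hp' h0]
  refine dirDeriv_linQuadCGF_append_pair (integral_id_finiteLaw hX hmean I) hr hr0
    (fun x => ?_) rfl ?_
  -- Extension by zero turns a vector on `I` into a restriction.
  · obtain ⟨y, rfl⟩ : ∃ y : T → ℝ, I.restrict y = x := by
      classical
      exact ⟨fun c => if hc : c ∈ I then x ⟨c, hc⟩ else 0, by ext i; simp⟩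
    rw [CumulantEntry.linQuadForm_direction hab,
      CumulantEntry.linQuadForm_direction (by simpa [CumulantEntry.indices] using ha),
      CumulantEntry.linQuadForm_direction (by simpa [CumulantEntry.indices] using hb)]
    rfl
  · simp only [hV, List.map_map, List.mem_map]
    rintro _ ⟨d, -, rfl⟩
    rfl

end MixedCumulants

theorem mainTheorem2 {T Ω : Type*} {mΩ : MeasurableSpace Ω} (P : Measure Ω)
    [IsProbabilityMeasure P] (X : T → Ω → ℝ) (hX : IsGaussianProcess X P)
    (hmean : ∀ a, ∫ ω, X a ω ∂P = 0) :
    -- all cumulants of singlets and doublets are well defined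
    (∀ L : List (CumulantEntry T), JointCumulantExists P (entryFamily X L)) ∧
    -- exactly one singlet, any number of doublets
    (∀ L : List (CumulantEntry T), L.countP CumulantEntry.isSinglet = 1 →
      mixedCumulant P X L = 0) ∧
    -- more than two singlets, any number of doublets
    (∀ L : List (CumulantEntry T), 2 < L.countP CumulantEntry.isSinglet →
      mixedCumulant P X L = 0) ∧
    -- exactly two singlets: they may be merged into one doublet (entries in any order)
    (∀ (a b : T) (D : List (T × T)) (L L' : List (CumulantEntry T)),
      L.Perm (.singlet a :: .singlet b :: D.map fun d => .doublet d.1 d.2) →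
      L'.Perm (.doublet a b :: D.map fun d => .doublet d.1 d.2) →
      mixedCumulant P X L = mixedCumulant P X L') := by
  exact ⟨jointCumulantExists_entryFamily hX,
    fun L hL => mixedCumulant_eq_zero hX hmean (.inl hL),
    fun L hL => mixedCumulant_eq_zero hX hmean (.inr hL),
    fun a b D L L' => mixedCumulant_singlet_singlet hX hmean a b D⟩
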